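/- Let $\omega:=\frac{-1+\sqrt{3}\,i}{2}$ and let $\alpha,\beta>0$ be real numbers such that $\alpha\beta^3=\pi^4$. Then all the series below converge absolutely, and \begin{align*} &\alpha^{-3/2}\left(\frac12\zeta(7)+\sum_{n=1}^{\infty}\frac{1}{n^7\left(\exp(8n^3\alpha)-1\right)}\right)\\ &=\frac{\beta^{15/2}}{748440}+\frac{\alpha^{1/2}\beta^3}{135}-\frac{16}{3}\beta^{-3/2}\Bigg(\frac12\zeta(3)-\sum_{n=1}^{\infty}\frac{n^{-3}}{\exp\left((2n)^{1/3}\beta\right)-1}\\ &\quad+\sum_{n=1}^{\infty}\frac{n^{-3}}{\exp\left(-(2n)^{1/3}\beta\omega\right)-1}+\sum_{n=1}^{\infty}\frac{n^{-3}}{\exp\left(-(2n)^{1/3}\beta\omega^2\right)-1}\Bigg), \end{align*} where $\zeta$ is the Riemann zeta function and $(2n)^{1/3}$ is the real cube root. -/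

import Mathlib

lemma hasSum_of_eq {ι : Type*} {f g : ι → ℂ} {a b : ℂ} (h : HasSum f a) (hf : ∀ i, g i = f i)
    (ha : b = a) : HasSum g b := by
  rw [ha, show g = f from funext hf]
  exact h

open Complex in
/-- The partial fraction expansion of `1 / (exp z - 1)`. -/
lemma hasSum_inv_exp_sub_one {z : ℂ} (hz : z.re ≠ 0) :
    HasSum (fun n : ℕ+ => 2 * z / (z ^ 2 + 4 * (Real.pi : ℂ) ^ 2 * (n : ℂ) ^ 2))
      (1 / (exp z - 1) + 1 / 2 - 1 / z) := by
  have hpi : (Real.pi : ℂ) ≠ 0 := by exact_mod_cast Real.pi_ne_zero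
  have hz0 : z ≠ 0 := by rintro rfl; simp at hz
  obtain ⟨x, rfl⟩ : ∃ x : ℂ, z = 2 * Real.pi * I * x := ⟨z / (2 * Real.pi * I), by field_simp⟩
  have hx0 : x ≠ 0 := by rintro rfl; simp at hz0
  have hx : x ∈ Complex.integerComplement := by
    rintro ⟨m, rfl⟩
    simp at hz
  have hne (n : ℕ+) : x - n ≠ 0 ∧ x + n ≠ 0 := by
    constructor
    · intro h
      exact hx ⟨(n : ℤ), by push_cast; linear_combination -h⟩
    · intro h
      exact hx ⟨-(n : ℤ), by push_cast; linear_combination -h⟩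
  have hexp : 1 - exp (2 * Real.pi * I * x) ≠ 0 := by
    intro h
    obtain ⟨m, hm⟩ := Complex.exp_eq_one_iff.1 (sub_eq_zero.1 h).symm
    refine hx ⟨m, ?_⟩
    have : (2 * Real.pi * I) * (m - x) = 0 := by linear_combination -hm
    rcases mul_eq_zero.1 this with h | h
    · simp [hpi] at h
    · linear_combination h
  have hexp' : exp (2 * Real.pi * I * x) - 1 ≠ 0 := fun h => hexp (by linear_combination -h)
  have hs : Summable (fun n : ℕ+ => 1 / (x - n) + 1 / (x + n)) := by
    rw [summable_pnat_iff_summable_succ (f := fun n : ℕ => 1 / (x - n) + 1 / (x + n))]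
    simpa [cotTerm] using summable_cotTerm hx
  have h := hs.hasSum
  rw [← sub_eq_of_eq_add' (cot_series_rep hx), Complex.cot_pi_eq_exp_ratio] at h
  refine hasSum_of_eq (h.div_const (2 * Real.pi * I)) (fun n => ?_) ?_
  · obtain ⟨h1, h2⟩ := hne n
    have h3 : (2 * Real.pi * I * x) ^ 2 + 4 * (Real.pi : ℂ) ^ 2 * (n : ℂ) ^ 2
        = -(4 * (Real.pi : ℂ) ^ 2 * ((x - n) * (x + n))) := by
      linear_combination 4 * (Real.pi : ℂ) ^ 2 * x ^ 2 * I_sq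
    rw [h3]
    field_simp
    linear_combination (-8 * x) * I_sq
  · generalize exp (2 * Real.pi * I * x) = E at *
    field_simp
    linear_combination (Real.pi * x * (1 - E ^ 2)) * I_sq

lemma hasSum_one_div_pnat_pow {k : ℕ} (hk : 1 < k) :
    HasSum (fun n : ℕ+ => 1 / (n : ℂ) ^ k) (riemannZeta k) := by
  have hs : Summable (fun n : ℕ => 1 / (n : ℂ) ^ k) := by
    have := (Real.summable_one_div_nat_pow (p := k)).2 hk
    simpa using Complex.summable_ofReal.2 this
  rw [zeta_nat_eq_tsum_of_gt_one hk,
    ← tsum_zero_pnat_eq_tsum_nat hs]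
  simp only [CharP.cast_eq_zero]
  rw [zero_pow (by lia), div_zero, zero_add]
  exact (summable_pnat_iff_summable_nat.2 hs).hasSum

lemma riemannZeta_ten : riemannZeta 10 = (Real.pi : ℂ) ^ 10 / 93555 := by
  have h := riemannZeta_two_mul_nat (k := 5) (by norm_num)
  have hb : bernoulli 10 = 5 / 66 := by
    rw [bernoulli_eq_bernoulli'_of_ne_one (by norm_num)]
    have h5 : bernoulli' 5 = 0 := by
      rw [bernoulli'_def]; norm_num [Finset.sum_range_succ, Nat.choose]
    have h6 : bernoulli' 6 = 1 / 42 := by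
      rw [bernoulli'_def]; norm_num [Finset.sum_range_succ, Nat.choose, h5]
    have h7 : bernoulli' 7 = 0 := by
      rw [bernoulli'_def]; norm_num [Finset.sum_range_succ, Nat.choose, h5, h6]
    have h8 : bernoulli' 8 = -1 / 30 := by
      rw [bernoulli'_def]; norm_num [Finset.sum_range_succ, Nat.choose, h5, h6, h7]
    have h9 : bernoulli' 9 = 0 := by
      rw [bernoulli'_def]; norm_num [Finset.sum_range_succ, Nat.choose, h5, h6, h7, h8]
    rw [bernoulli'_def]; norm_num [Finset.sum_range_succ, Nat.choose, h5, h6, h7, h8, h9]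
  norm_num [hb, Nat.factorial] at h
  rw [h]
  ring

lemma summable_one_div_pow_div_exp_sub_one {w : ℕ+ → ℂ} {δ : ℝ} (hδ : 0 < δ)
    (hw : ∀ n, δ ≤ (w n).re) {k : ℕ} (hk : 1 < k) :
    Summable (fun n : ℕ+ => 1 / (n : ℂ) ^ k / (Complex.exp (w n) - 1)) := by
  refine Summable.of_norm_bounded ((hasSum_one_div_pnat_pow hk).summable.norm.mul_right δ⁻¹)
    fun n => ?_
  rw [norm_div, div_eq_mul_inv]
  gcongr
  calc δ ≤ (w n).re := hw n
    _ ≤ Real.exp (w n).re - 1 := by linarith [Real.add_one_le_exp (w n).re]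
    _ = ‖Complex.exp (w n)‖ - ‖(1 : ℂ)‖ := by rw [Complex.norm_exp, norm_one]
    _ ≤ _ := norm_sub_norm_le _ _

lemma cubic_partial_fraction {y c ω : ℂ} (hω : ω ^ 2 + ω + 1 = 0) (h : c ^ 3 + y ^ 6 ≠ 0) :
    -(2 * y / (y ^ 2 + c)) + 2 * (-(y * ω)) / ((-(y * ω)) ^ 2 + c)
      + 2 * (-(y * ω ^ 2)) / ((-(y * ω ^ 2)) ^ 2 + c) = 6 * (y ^ 3 * c / (c ^ 3 + y ^ 6)) := by
  have h3 : ω ^ 3 = 1 := by linear_combination (ω - 1) * hω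
  have e2 : (-(y * ω)) ^ 2 = ω ^ 2 * y ^ 2 := by ring
  have e3 : (-(y * ω ^ 2)) ^ 2 = ω * y ^ 2 := by linear_combination y ^ 2 * ω * h3
  rw [e2, e3]
  have hp : (y ^ 2 + c) * ((ω ^ 2 * y ^ 2 + c) * (ω * y ^ 2 + c)) = c ^ 3 + y ^ 6 := by grind
  rw [← hp] at h ⊢
  obtain ⟨h1, h2, h4⟩ : y ^ 2 + c ≠ 0 ∧ ω ^ 2 * y ^ 2 + c ≠ 0 ∧ ω * y ^ 2 + c ≠ 0 := by
    simpa [not_or] using h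
  rw [← neg_div, div_add_div _ _ h1 h2, div_add_div _ _ (mul_ne_zero h1 h2) h4, mul_div_assoc',
    mul_assoc (y ^ 2 + c)]
  congr 1
  · grind
  · ring

/-- The combination of three exponentials over the cube roots of unity, as a series. -/
lemma hasSum_cube_roots_inv_exp_sub_one {y : ℝ} (hy : 0 < y) {ω : ℂ} (hω : ω ^ 2 + ω + 1 = 0)
    (hre : ω.re = -1 / 2) :
    HasSum (fun n : ℕ+ => 6 * ((y : ℂ) ^ 3 * (4 * (Real.pi : ℂ) ^ 2 * (n : ℂ) ^ 2) /
        ((4 * (Real.pi : ℂ) ^ 2 * (n : ℂ) ^ 2) ^ 3 + (y : ℂ) ^ 6)))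
      (1 / 2 - 1 / (Complex.exp y - 1) + 1 / (Complex.exp (-(y * ω)) - 1)
        + 1 / (Complex.exp (-(y * ω ^ 2)) - 1)) := by
  have hre2 : (ω ^ 2).re = -1 / 2 := by
    rw [show ω ^ 2 = -1 - ω by linear_combination hω]
    simp [hre]; norm_num
  have h1 := hasSum_inv_exp_sub_one (z := y) (by simpa using hy.ne')
  have h2 := hasSum_inv_exp_sub_one (z := -(y * ω)) (by simp [hre, hy.ne'])
  have h3 := hasSum_inv_exp_sub_one (z := -(y * ω ^ 2)) (by
    rw [Complex.neg_re, Complex.re_ofReal_mul, hre2]; simp [hy.ne'])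
  have hω0 : ω ≠ 0 := by rintro rfl; simp at hω
  have hy0 : (y : ℂ) ≠ 0 := by exact_mod_cast hy.ne'
  refine hasSum_of_eq ((h1.neg.add h2).add h3) (fun n => ?_) ?_
  · refine (cubic_partial_fraction hω ?_).symm
    have : (0 : ℝ) < (4 * Real.pi ^ 2 * (n : ℝ) ^ 2) ^ 3 + y ^ 6 := by positivity
    exact_mod_cast this.ne'
  · have : 1 / (y : ℂ) - 1 / (-(y * ω)) - 1 / (-(y * ω ^ 2)) = 0 := by
      field_simp
      linear_combination hω
    linear_combination -this

/-- Decomposition of the double series with terms `1 / (n ^ 4 * (16 n ^ 6 a ^ 2 + π ^ 2 m ^ 2))`. -/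
lemma exists_hasSum_double_series {a : ℝ} (ha : 0 < a) : ∃ S : ℂ,
    HasSum (fun p : ℕ+ × ℕ+ => (p.1 : ℂ) ^ 2 / ((p.2 : ℂ) ^ 2 *
      (16 * (p.1 : ℂ) ^ 6 * (a : ℂ) ^ 2 + (Real.pi : ℂ) ^ 2 * (p.2 : ℂ) ^ 2))) S ∧
    HasSum (fun p : ℕ+ × ℕ+ => 1 / ((p.1 : ℂ) ^ 4 *
      (16 * (p.1 : ℂ) ^ 6 * (a : ℂ) ^ 2 + (Real.pi : ℂ) ^ 2 * (p.2 : ℂ) ^ 2)))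
      ((Real.pi : ℂ) ^ 4 / 540 - 16 * (a : ℂ) ^ 2 / (Real.pi : ℂ) ^ 2 * S) := by
  have h4 := hasSum_one_div_pnat_pow (k := 4) (by norm_num)
  have h2 := hasSum_one_div_pnat_pow (k := 2) (by norm_num)
  have hprod := summable_mul_of_summable_norm h4.summable.norm h2.summable.norm
  have hs : Summable (fun p : ℕ+ × ℕ+ => (p.1 : ℂ) ^ 2 / ((p.2 : ℂ) ^ 2 *
      (16 * (p.1 : ℂ) ^ 6 * (a : ℂ) ^ 2 + (Real.pi : ℂ) ^ 2 * (p.2 : ℂ) ^ 2))) := by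
    refine Summable.of_norm_bounded (hprod.norm.mul_right (1 / (16 * a ^ 2))) fun p => ?_
    obtain ⟨n, m⟩ := p
    have hn : (0 : ℝ) < n := by exact_mod_cast n.pos
    have hm : (0 : ℝ) < m := by exact_mod_cast m.pos
    have e1 : (n : ℂ) ^ 2 / ((m : ℂ) ^ 2 *
        (16 * (n : ℂ) ^ 6 * (a : ℂ) ^ 2 + (Real.pi : ℂ) ^ 2 * (m : ℂ) ^ 2))
        = (((n : ℝ) ^ 2 / ((m : ℝ) ^ 2 * (16 * (n : ℝ) ^ 6 * a ^ 2 + Real.pi ^ 2 * (m : ℝ) ^ 2))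
          : ℝ) : ℂ) := by push_cast; rfl
    have e2 : 1 / (n : ℂ) ^ 4 * (1 / (m : ℂ) ^ 2)
        = ((1 / (n : ℝ) ^ 4 * (1 / (m : ℝ) ^ 2) : ℝ) : ℂ) := by push_cast; rfl
    dsimp only
    rw [e1, e2, Complex.norm_real, Complex.norm_real, Real.norm_of_nonneg (by positivity),
      Real.norm_of_nonneg (by positivity)]
    calc (n : ℝ) ^ 2 / ((m : ℝ) ^ 2 * (16 * (n : ℝ) ^ 6 * a ^ 2 + Real.pi ^ 2 * (m : ℝ) ^ 2))
        ≤ (n : ℝ) ^ 2 / ((m : ℝ) ^ 2 * (16 * (n : ℝ) ^ 6 * a ^ 2)) := by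
          gcongr
          exact le_add_of_nonneg_right (by positivity)
      _ = _ := by field_simp
  refine ⟨_, hs.hasSum, ?_⟩
  have hpi : (Real.pi : ℂ) ≠ 0 := by exact_mod_cast Real.pi_ne_zero
  refine hasSum_of_eq (((h4.mul h2 hprod).div_const ((Real.pi : ℂ) ^ 2)).sub
    (hs.hasSum.mul_left (16 * (a : ℂ) ^ 2 / (Real.pi : ℂ) ^ 2))) (fun p => ?_) ?_
  · obtain ⟨n, m⟩ := p
    have hn : (n : ℂ) ≠ 0 := by exact_mod_cast n.ne_zero
    have hm : (m : ℂ) ≠ 0 := by exact_mod_cast m.ne_zero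
    have hd : 16 * (n : ℂ) ^ 6 * (a : ℂ) ^ 2 + (Real.pi : ℂ) ^ 2 * (m : ℂ) ^ 2 ≠ 0 := by
      have hn : (0 : ℝ) < n := by exact_mod_cast n.pos
      have : (0 : ℝ) < 16 * (n : ℝ) ^ 6 * a ^ 2 + Real.pi ^ 2 * (m : ℝ) ^ 2 := by positivity
      exact_mod_cast this.ne'
    dsimp only
    generalize hD : 16 * (n : ℂ) ^ 6 * (a : ℂ) ^ 2 + (Real.pi : ℂ) ^ 2 * (m : ℂ) ^ 2 = D at hd ⊢
    field_simp
    rw [← hD]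
    ring
  · push_cast
    rw [riemannZeta_two, riemannZeta_four]
    field_simp
    ring

lemma hasSum_exp_side {a : ℝ} (ha : 0 < a) {F : ℂ}
    (hF : HasSum (fun p : ℕ+ × ℕ+ => 1 / ((p.1 : ℂ) ^ 4 *
      (16 * (p.1 : ℂ) ^ 6 * (a : ℂ) ^ 2 + (Real.pi : ℂ) ^ 2 * (p.2 : ℂ) ^ 2))) F) :
    HasSum (fun n : ℕ+ => 1 / 2 * (1 / (n : ℂ) ^ 7)
        + 1 / (n : ℂ) ^ 7 / (Complex.exp (8 * (n : ℂ) ^ 3 * (a : ℂ)) - 1))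
      ((Real.pi : ℂ) ^ 10 / 93555 / (8 * a) + 4 * a * F) := by
  have ha0 : (a : ℂ) ≠ 0 := by exact_mod_cast ha.ne'
  have h10 := hasSum_one_div_pnat_pow (k := 10) (by norm_num)
  push_cast at h10
  rw [riemannZeta_ten] at h10
  have hfib (n : ℕ+) : HasSum (fun m : ℕ+ => 1 / ((n : ℂ) ^ 4 *
      (16 * (n : ℂ) ^ 6 * (a : ℂ) ^ 2 + (Real.pi : ℂ) ^ 2 * (m : ℂ) ^ 2)))
      ((1 / 2 * (1 / (n : ℂ) ^ 7)
        + 1 / (n : ℂ) ^ 7 / (Complex.exp (8 * (n : ℂ) ^ 3 * (a : ℂ)) - 1)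
        - 1 / (n : ℂ) ^ 10 / (8 * a)) / (4 * a)) := by
    have hn : (n : ℂ) ≠ 0 := by exact_mod_cast n.ne_zero
    have hn' : (0 : ℝ) < n := by exact_mod_cast n.pos
    have hre : (8 * (n : ℂ) ^ 3 * (a : ℂ)).re ≠ 0 := by
      have : (8 * (n : ℂ) ^ 3 * (a : ℂ)) = ((8 * (n : ℝ) ^ 3 * a : ℝ) : ℂ) := by push_cast; rfl
      rw [this, Complex.ofReal_re]
      positivity
    refine hasSum_of_eq ((hasSum_inv_exp_sub_one hre).mul_left (1 / (n : ℂ) ^ 7 / (4 * a)))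
      (fun m => ?_) ?_
    · have hd : 16 * (n : ℂ) ^ 6 * (a : ℂ) ^ 2 + (Real.pi : ℂ) ^ 2 * (m : ℂ) ^ 2 ≠ 0 := by
        have : (0 : ℝ) < 16 * (n : ℝ) ^ 6 * a ^ 2 + Real.pi ^ 2 * (m : ℝ) ^ 2 := by positivity
        exact_mod_cast this.ne'
      rw [show (8 * (n : ℂ) ^ 3 * (a : ℂ)) ^ 2 + 4 * (Real.pi : ℂ) ^ 2 * (m : ℂ) ^ 2
        = 4 * (16 * (n : ℂ) ^ 6 * (a : ℂ) ^ 2 + (Real.pi : ℂ) ^ 2 * (m : ℂ) ^ 2) by ring]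
      field_simp
      norm_num
    · have : 1 / (n : ℂ) ^ 10 / (8 * a) = 1 / (n : ℂ) ^ 7 * (1 / (8 * (n : ℂ) ^ 3 * (a : ℂ))) := by
        field_simp
      rw [this]
      ring
  refine hasSum_of_eq ((h10.div_const (8 * (a : ℂ))).add
    ((hF.prod_fiberwise hfib).mul_left (4 * (a : ℂ)))) (fun n => ?_) rfl
  rw [mul_div_cancel₀ _ (mul_ne_zero (by norm_num) ha0)]
  ring

lemma hasSum_cube_root_side {a b : ℝ} (ha : 0 < a) (hb : 0 < b) (hab : a * b ^ 3 = Real.pi ^ 4)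
    {ω : ℂ} (hω : ω ^ 2 + ω + 1 = 0) (hre : ω.re = -1 / 2) {S : ℂ}
    (hS : HasSum (fun p : ℕ+ × ℕ+ => (p.1 : ℂ) ^ 2 / ((p.2 : ℂ) ^ 2 *
      (16 * (p.1 : ℂ) ^ 6 * (a : ℂ) ^ 2 + (Real.pi : ℂ) ^ 2 * (p.2 : ℂ) ^ 2))) S) :
    HasSum (fun m : ℕ+ => 1 / (m : ℂ) ^ 3 *
      (1 / 2 - 1 / (Complex.exp (((2 * (m : ℝ)) ^ (1 / 3 : ℝ) : ℝ) * (b : ℂ)) - 1)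
        + 1 / (Complex.exp (-(((2 * (m : ℝ)) ^ (1 / 3 : ℝ) : ℝ) * (b : ℂ) * ω)) - 1)
        + 1 / (Complex.exp (-(((2 * (m : ℝ)) ^ (1 / 3 : ℝ) : ℝ) * (b : ℂ) * ω ^ 2)) - 1)))
      (12 * a * S) := by
  have ha0 : (a : ℂ) ≠ 0 := by exact_mod_cast ha.ne'
  have hpi : (Real.pi : ℂ) ≠ 0 := by exact_mod_cast Real.pi_ne_zero
  have hb3 : (b : ℂ) ^ 3 = (Real.pi : ℂ) ^ 4 / a := by
    rw [eq_div_iff ha0, mul_comm]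
    exact_mod_cast hab
  refine HasSum.prod_fiberwise
    (((Equiv.prodComm ℕ+ ℕ+).hasSum_iff.2 hS).mul_left (12 * (a : ℂ))) fun m => ?_
  have hm : (m : ℂ) ≠ 0 := by exact_mod_cast m.ne_zero
  have hm' : (0 : ℝ) < m := by exact_mod_cast m.pos
  have hy : 0 < (2 * (m : ℝ)) ^ (1 / 3 : ℝ) * b := by positivity
  have h := hasSum_cube_roots_inv_exp_sub_one hy hω hre
  have hy3 : ((((2 * (m : ℝ)) ^ (1 / 3 : ℝ) * b : ℝ)) : ℂ) ^ 3
      = 2 * m * ((Real.pi : ℂ) ^ 4 / a) := by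
    rw [← hb3, Complex.ofReal_mul, mul_pow]
    congr 1
    have : ((2 * (m : ℝ)) ^ (1 / 3 : ℝ)) ^ 3 = 2 * m := by
      rw [← Real.rpow_natCast, ← Real.rpow_mul (by positivity)]
      norm_num
    exact_mod_cast this
  have hy6 : ((((2 * (m : ℝ)) ^ (1 / 3 : ℝ) * b : ℝ)) : ℂ) ^ 6
      = (2 * m * ((Real.pi : ℂ) ^ 4 / a)) ^ 2 := by rw [← hy3]; ring
  rw [hy3, hy6, Complex.ofReal_mul] at h
  refine hasSum_of_eq (h.mul_left (1 / (m : ℂ) ^ 3)) (fun n => ?_) rfl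
  have hn : (n : ℂ) ≠ 0 := by exact_mod_cast n.ne_zero
  have hd : 16 * (n : ℂ) ^ 6 * (a : ℂ) ^ 2 + (Real.pi : ℂ) ^ 2 * (m : ℂ) ^ 2 ≠ 0 := by
    have : (0 : ℝ) < 16 * (n : ℝ) ^ 6 * a ^ 2 + Real.pi ^ 2 * (m : ℝ) ^ 2 := by positivity
    exact_mod_cast this.ne'
  rw [show (4 * (Real.pi : ℂ) ^ 2 * (n : ℂ) ^ 2) ^ 3 + (2 * m * ((Real.pi : ℂ) ^ 4 / a)) ^ 2
    = 4 * (Real.pi : ℂ) ^ 6 / (a : ℂ) ^ 2 *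
      (16 * (n : ℂ) ^ 6 * (a : ℂ) ^ 2 + (Real.pi : ℂ) ^ 2 * (m : ℂ) ^ 2) by field_simp; ring]
  simp only [Function.comp_apply, Equiv.prodComm_apply, Prod.fst_swap, Prod.snd_swap]
  field_simp
  norm_num

theorem mainTheorem10 (α β : ℝ) (hα : 0 < α) (hβ : 0 < β) (hαβ : α * β ^ 3 = Real.pi ^ 4)
    (ω : ℂ) (hω : ω = (-1 + (Real.sqrt 3 : ℂ) * Complex.I) / 2) :
    Summable (fun n : ℕ+ => 1 / ((n : ℂ) ^ 7 * (Complex.exp (8 * (n : ℂ) ^ 3 * (α : ℂ)) - 1))) ∧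
    Summable (fun n : ℕ+ => (n : ℂ) ^ (-3 : ℤ) /
      (Complex.exp (((2 * (n : ℝ)) ^ (1 / 3 : ℝ) : ℝ) * (β : ℂ)) - 1)) ∧
    Summable (fun n : ℕ+ => (n : ℂ) ^ (-3 : ℤ) /
      (Complex.exp (-(((2 * (n : ℝ)) ^ (1 / 3 : ℝ) : ℝ) * (β : ℂ) * ω)) - 1)) ∧
    Summable (fun n : ℕ+ => (n : ℂ) ^ (-3 : ℤ) /
      (Complex.exp (-(((2 * (n : ℝ)) ^ (1 / 3 : ℝ) : ℝ) * (β : ℂ) * ω ^ 2)) - 1)) ∧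
    ((α ^ (-(3 / 2) : ℝ) : ℝ) : ℂ) *
        (1 / 2 * riemannZeta 7 +
          ∑' n : ℕ+, 1 / ((n : ℂ) ^ 7 * (Complex.exp (8 * (n : ℂ) ^ 3 * (α : ℂ)) - 1))) =
      ((β ^ (15 / 2 : ℝ) : ℝ) : ℂ) / 748440 + ((α ^ (1 / 2 : ℝ) : ℝ) : ℂ) * (β : ℂ) ^ 3 / 135 -
        16 / 3 * ((β ^ (-(3 / 2) : ℝ) : ℝ) : ℂ) *
          (1 / 2 * riemannZeta 3 -
            (∑' n : ℕ+, (n : ℂ) ^ (-3 : ℤ) /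
              (Complex.exp (((2 * (n : ℝ)) ^ (1 / 3 : ℝ) : ℝ) * (β : ℂ)) - 1)) +
            (∑' n : ℕ+, (n : ℂ) ^ (-3 : ℤ) /
              (Complex.exp (-(((2 * (n : ℝ)) ^ (1 / 3 : ℝ) : ℝ) * (β : ℂ) * ω)) - 1)) +
            (∑' n : ℕ+, (n : ℂ) ^ (-3 : ℤ) /
              (Complex.exp (-(((2 * (n : ℝ)) ^ (1 / 3 : ℝ) : ℝ) * (β : ℂ) * ω ^ 2)) - 1))) := by

  have hsqrt : ((Real.sqrt 3 : ℝ) : ℂ) ^ 2 = 3 := by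
    exact_mod_cast Real.sq_sqrt (show (0 : ℝ) ≤ 3 by norm_num)
  have hω2 : ω ^ 2 + ω + 1 = 0 := by
    rw [hω]
    linear_combination (Complex.I ^ 2 / 4) * hsqrt + 3 / 4 * Complex.I_sq
  have hre : ω.re = -1 / 2 := by
    rw [hω, show (-1 + (Real.sqrt 3 : ℂ) * Complex.I) / 2
      = ((-1 / 2 : ℝ) : ℂ) + ((Real.sqrt 3 / 2 : ℝ) : ℂ) * Complex.I by push_cast; ring]
    simp
  have hre2 : (ω ^ 2).re = -1 / 2 := by
    rw [show ω ^ 2 = -1 - ω by linear_combination hω2]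
    simp [hre]
    norm_num
  have hn1 (n : ℕ+) : (1 : ℝ) ≤ n := by exact_mod_cast one_le (a := n)
  have hroot (n : ℕ+) : β ≤ (2 * (n : ℝ)) ^ (1 / 3 : ℝ) * β :=
    le_mul_of_one_le_left hβ.le (Real.one_le_rpow (by linarith [hn1 n]) (by norm_num))
  have hz3 (n : ℕ+) : (n : ℂ) ^ (-3 : ℤ) = 1 / (n : ℂ) ^ 3 := by
    rw [zpow_neg, one_div]
    norm_cast
  have s1 := summable_one_div_pow_div_exp_sub_one (w := fun n : ℕ+ => 8 * (n : ℂ) ^ 3 * (α : ℂ))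
    hα (fun n => by
      have h := hn1 n
      have e : (8 * (n : ℂ) ^ 3 * (α : ℂ)) = ((8 * (n : ℝ) ^ 3 * α : ℝ) : ℂ) := by
        push_cast; rfl
      rw [e, Complex.ofReal_re]
      exact le_mul_of_one_le_left hα.le (by linarith [one_le_pow₀ (n := 3) h]))
    (k := 7) (by norm_num)
  have s2 := summable_one_div_pow_div_exp_sub_one
    (w := fun n : ℕ+ => ((2 * (n : ℝ)) ^ (1 / 3 : ℝ) : ℝ) * (β : ℂ)) hβ (fun n => by
      rw [← Complex.ofReal_mul, Complex.ofReal_re]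
      exact hroot n) (k := 3) (by norm_num)
  have s3 := summable_one_div_pow_div_exp_sub_one
    (w := fun n : ℕ+ => -(((2 * (n : ℝ)) ^ (1 / 3 : ℝ) : ℝ) * (β : ℂ) * ω)) (half_pos hβ)
    (fun n => by
      rw [← Complex.ofReal_mul, Complex.neg_re, Complex.re_ofReal_mul, hre]
      linarith [hroot n]) (k := 3) (by norm_num)
  have s4 := summable_one_div_pow_div_exp_sub_one
    (w := fun n : ℕ+ => -(((2 * (n : ℝ)) ^ (1 / 3 : ℝ) : ℝ) * (β : ℂ) * ω ^ 2)) (half_pos hβ)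
    (fun n => by
      rw [← Complex.ofReal_mul, Complex.neg_re, Complex.re_ofReal_mul, hre2]
      linarith [hroot n]) (k := 3) (by norm_num)
  simp only [hz3, ← div_div]
  refine ⟨s1, s2, s3, s4, ?_⟩
  obtain ⟨S, hS, hF⟩ := exists_hasSum_double_series hα
  have hL := (((hasSum_one_div_pnat_pow (k := 7) (by norm_num)).mul_left (1 / 2)).add
    s1.hasSum).unique (hasSum_exp_side hα hF)
  have hR := HasSum.unique (hasSum_of_eq (((((hasSum_one_div_pnat_pow (k := 3)
    (by norm_num)).mul_left (1 / 2)).sub s2.hasSum).add s3.hasSum).add s4.hasSum)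
    (fun n => by ring) rfl) (hasSum_cube_root_side hα hβ hαβ hω2 hre hS)
  push_cast at hL hR
  rw [hL, hR]
  obtain ⟨r, hr, rfl⟩ : ∃ r : ℝ, 0 < r ∧ α = r ^ 2 :=
    ⟨√α, Real.sqrt_pos.2 hα, (Real.sq_sqrt hα.le).symm⟩
  obtain ⟨t, ht, rfl⟩ : ∃ t : ℝ, 0 < t ∧ β = t ^ 2 :=
    ⟨√β, Real.sqrt_pos.2 hβ, (Real.sq_sqrt hβ.le).symm⟩
  have hrt : r * t ^ 3 = Real.pi ^ 2 := by
    refine (pow_left_inj₀ (by positivity) (by positivity) two_ne_zero).1 ?_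
    linear_combination hαβ
  have p1 : (r ^ 2) ^ (-(3 / 2) : ℝ) = (r ^ 3)⁻¹ := by
    rw [← Real.rpow_natCast, ← Real.rpow_mul hr.le, ← Real.rpow_natCast, ← Real.rpow_neg hr.le]
    norm_num
  have p2 : (r ^ 2) ^ (1 / 2 : ℝ) = r := by
    rw [← Real.rpow_natCast, ← Real.rpow_mul hr.le]
    norm_num
  have p3 : (t ^ 2) ^ (15 / 2 : ℝ) = (t ^ 3) ^ 5 := by
    rw [← pow_mul, ← Real.rpow_natCast, ← Real.rpow_mul ht.le, ← Real.rpow_natCast]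
    norm_num
  have p4 : (t ^ 2) ^ (-(3 / 2) : ℝ) = (t ^ 3)⁻¹ := by
    rw [← Real.rpow_natCast, ← Real.rpow_mul ht.le, ← Real.rpow_natCast, ← Real.rpow_neg ht.le]
    norm_num
  have hr0 : (r : ℂ) ≠ 0 := by exact_mod_cast hr.ne'
  have hpi : (Real.pi : ℂ) ≠ 0 := by exact_mod_cast Real.pi_ne_zero
  have ht3 : (t : ℂ) ^ 3 = (Real.pi : ℂ) ^ 2 / r := by
    rw [eq_div_iff hr0, mul_comm]
    exact_mod_cast hrt
  rw [p1, p2, p3, p4]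
  push_cast
  rw [show ((t : ℂ) ^ 2) ^ 3 = ((t : ℂ) ^ 3) ^ 2 by ring, ht3]
  field_simp
  ring
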